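/- Let $\mathbb X\subset\mathbb R^d$ be a Borel set (state space), let $\mathbb U\subset\mathbb R^m$ be compact (action space), and let $c:\mathbb X\times\mathbb U\to\mathbb R$ be bounded and Borel measurable. Let $\mathcal T$ and $\mathcal T_n$ $(n\in\mathbb N)$ be stochastic kernels from $\mathbb X\times\mathbb U$ to $\mathbb X$. An admissible policy is a sequence $\gamma=(\gamma_t)_{t\ge 0}$ of measurable maps with $U_t=\gamma_t(X_0,\dots,X_t,U_0,\dots,U_{t-1})\in\mathbb U$; under $\gamma$ and a kernel $\mathcal S$, started at $X_0=x_0$, the state $X_{t+1}$ has conditional law $\mathcal S(\cdot\mid X_t,U_t)$ given the past. Put $$J_\infty(\mathcal S,\gamma)=\limsup_{N\to\infty}\frac1N E^{\mathcal S,\gamma}_{x_0}\Big[\sum_{t=0}^{N-1}c(X_t,U_t)\Big],\qquad J^*_\infty(\mathcal S)=\inf_\gamma J_\infty(\mathcal S,\gamma),$$ the infimum being over all admissible policies. For measurable $\gamma:\mathbb X\to\mathbb U$ (a stationary policy) let $\mathcal S^t(\cdot\mid x,\gamma)$ be the $t$-step transition kernel of the Markov chain with kernel $\mathcal S(\cdot\mid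 x,\gamma(x))$, and let $\|\mu-\nu\|_{TV}=\sup_{|f|\le 1}|\int f\,d\mu-\int f\,d\nu|$, the supremum being over measurable $f$. Say that a family $(\mathcal S_i)_i$ of kernels is uniformly ergodic if there are an integer $t\ge1$ and a number $0<\beta<1$ such that $\|\mathcal S_i^t(\cdot\mid x,\gamma)-\mathcal S_i^t(\cdot\mid x',\gamma)\|_{TV}\le 2\beta$ for all $i$, all $x,x'\in\mathbb X$ and all stationary policies $\gamma$. Assume that $\mathcal T$ (alone) and the family $(\mathcal T_n)_n$ are uniformly ergodic. Then, for every initial state $x_0\in\mathbb X$, $|J^*_\infty(\mathcal T_n)-J^*_\infty(\mathcal T)|\to 0$ as $n\to\infty$ under either of the following sets of conditions. (c1) $c$ is continuous; $\mathcal T(\cdot\mid x,u)$ and each $\mathcal T_n(\cdot\mid x,u)$ are weakly continuous in $(x,u)$; and $\mathcal T_n(\cdot\mid x_n,u_n)\to\mathcal T(\cdot\mid x,u)$ weakly whenever $(x_n,u_n)\to(x,u)$ in $\mathbb X\times\mathbb U$. (c2) For every fixed $x$, $c(x,u)$ is continuous in $u$, and $\mathcal T(\cdot\mid x,u)$ and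 each $\mathcal T_n(\cdot\mid x,u)$ are setwise continuous in $u$; and for every fixed $x$, $\mathcal T_n(\cdot\mid x,u_n)\to\mathcal T(\cdot\mid x,u)$ setwise whenever $u_n\to u$ in $\mathbb U$. Here $\mu_n\to\mu$ weakly (setwise) means $\int f\,d\mu_n\to\int f\,d\mu$ for all bounded continuous (bounded measurable) $f:\mathbb X\to\mathbb R$. -/

import Mathlib

open MeasureTheory ProbabilityTheory Filter Topology BoundedContinuousFunction

namespace AvgCostMDP

/-- Realizations of the information vector `I_t = (X_0, …, X_t, U_0, …, U_{t-1})`. -/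
abbrev Info (X U : Type*) (t : ℕ) : Type _ := (Fin (t + 1) → X) × (Fin t → U)

section Model

variable {X U : Type*} [MeasurableSpace X] [MeasurableSpace U]

/-- An admissible policy: measurable control functions `γ_t`, with `U_t = γ_t(I_t)`. -/
structure Policy (X U : Type*) [MeasurableSpace X] [MeasurableSpace U] where
  act : (t : ℕ) → Info X U t → U
  measurable_act : ∀ t, Measurable (act t)

/-- The pair `(X_t, U_t)` read off from `I_t` under the policy `γ`. -/
def Policy.stateAction (γ : Policy X U) (t : ℕ) (h : Info X U t) : X × U :=
  (h.1 (Fin.last t), γ.act t h)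

theorem Policy.measurable_stateAction (γ : Policy X U) (t : ℕ) :
    Measurable (γ.stateAction t) :=
  ((measurable_pi_apply _).comp measurable_fst).prodMk (γ.measurable_act t)

/-- The update `(I_t, X_{t+1}) ↦ I_{t+1}`, which appends `U_t = γ_t(I_t)` and `X_{t+1}`. -/
def Policy.update (γ : Policy X U) (t : ℕ) (p : Info X U t × X) : Info X U (t + 1) :=
  (Fin.snoc p.1.1 p.2, Fin.snoc p.1.2 (γ.act t p.1))

theorem Policy.measurable_update (γ : Policy X U) (t : ℕ) : Measurable (γ.update t) := by
  refine Measurable.prodMk (measurable_pi_iff.2 fun i => ?_) (measurable_pi_iff.2 fun i => ?_)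
  · refine Fin.lastCases ?_ (fun j => ?_) i
    · simpa using measurable_snd
    · simp only [Fin.snoc_castSucc]
      exact (measurable_pi_apply j).comp (measurable_fst.comp measurable_fst)
  · refine Fin.lastCases ?_ (fun j => ?_) i
    · simp only [Fin.snoc_last]
      exact (γ.measurable_act t).comp measurable_fst
    · simp only [Fin.snoc_castSucc]
      exact (measurable_pi_apply j).comp (measurable_snd.comp measurable_fst)

/-- The joint law of `I_t` under the policy `γ`, the initial state `x₀` and the transition
kernel `T`: given `I_t`, the next state has law `T(· | X_t, U_t)`. -/
noncomputable def infoLaw (T : Kernel (X × U) X) (γ : Policy X U) (x₀ : X) :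
    (t : ℕ) → Measure (Info X U t)
  | 0 => Measure.dirac (fun _ => x₀, Fin.elim0)
  | t + 1 => (infoLaw T γ x₀ t ⊗ₘ
      T.comap (γ.stateAction t) (γ.measurable_stateAction t)).map (γ.update t)

instance isProbabilityMeasure_infoLaw (T : Kernel (X × U) X) [IsMarkovKernel T]
    (γ : Policy X U) (x₀ : X) (t : ℕ) : IsProbabilityMeasure (infoLaw T γ x₀ t) := by
  induction t with
  | zero => rw [infoLaw]; infer_instance
  | succ t ih =>
    rw [infoLaw]
    exact Measure.isProbabilityMeasure_map (γ.measurable_update t).aemeasurable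

/-- `E_{x₀}^{T,γ} [∑_{t < N} c(X_t, U_t)]`. -/
noncomputable def totalCost (c : X × U → ℝ) (T : Kernel (X × U) X) (γ : Policy X U) (x₀ : X)
    (N : ℕ) : ℝ :=
  ∫ h, ∑ t : Fin N, c (h.1 t.castSucc, h.2 t) ∂(infoLaw T γ x₀ N)

/-- The infinite-horizon average expected cost `J_∞(T, γ)` from the initial state `x₀`.
It is used only for bounded measurable `c`. -/
noncomputable def avgCost (c : X × U → ℝ) (T : Kernel (X × U) X) (γ : Policy X U) (x₀ : X) : ℝ :=
  limsup (fun N : ℕ => (1 / (N : ℝ)) * totalCost c T γ x₀ N) atTop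

/-- The optimal average cost `J*_∞(T)` from the initial state `x₀`: the infimum over all
admissible policies. -/
noncomputable def optAvgCost (c : X × U → ℝ) (T : Kernel (X × U) X) (x₀ : X) : ℝ :=
  ⨅ γ : Policy X U, avgCost c T γ x₀

/-- The total variation distance, normalized as the supremum of `|∫ f dμ - ∫ f dν|` over
measurable `f` with `|f| ≤ 1`. -/
noncomputable def tvDist (μ ν : Measure X) : ℝ :=
  sSup {r : ℝ | ∃ f : X → ℝ, Measurable f ∧ (∀ x, |f x| ≤ 1) ∧
    r = |∫ x, f x ∂μ - ∫ x, f x ∂ν|}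

/-- The kernel `T(· | x, γ) = T(· | x, γ(x))` of a stationary policy `γ`. -/
noncomputable def closedLoop (T : Kernel (X × U) X) (γ : X → U) (hγ : Measurable γ) : Kernel X X :=
  T.comap (fun x => (x, γ x)) (measurable_id.prodMk hγ)

/-- `‖T^t(· | x, γ) - T^t(· | x', γ)‖_TV ≤ 2 β` for all states `x`, `x'` and all stationary
policies `γ`. The power is the iterated composition of kernels. -/
def TVContraction (T : Kernel (X × U) X) (t : ℕ) (β : ℝ) : Prop :=
  ∀ (γ : X → U) (hγ : Measurable γ) (x x' : X),
    tvDist ((closedLoop T γ hγ ^ t) x) ((closedLoop T γ hγ ^ t) x') ≤ 2 * β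

/-- Uniform ergodicity of a family of transition kernels: there are `t ≥ 1` and `0 < β < 1`,
the same for the whole family, for which the `t`-step contraction holds. -/
def UniformlyErgodic {ι : Type*} (T : ι → Kernel (X × U) X) : Prop :=
  ∃ t : ℕ, 0 < t ∧ ∃ β : ℝ, 0 < β ∧ β < 1 ∧ ∀ i, TVContraction (T i) t β

/-- Setwise convergence: convergence of the integrals of all bounded measurable functions. -/
def SetwiseTendsto (μ : ℕ → Measure X) (ν : Measure X) : Prop :=
  ∀ f : X → ℝ, Measurable f → (∃ M : ℝ, ∀ x, |f x| ≤ M) →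
    Tendsto (fun n => ∫ x, f x ∂(μ n)) atTop (𝓝 (∫ x, f x ∂ν))

/-- `T(· | x, u)` is setwise continuous in `u` for every fixed `x`. -/
def SetwiseContinuousInAction [TopologicalSpace U] (T : Kernel (X × U) X) : Prop :=
  ∀ (x : X) (f : X → ℝ), Measurable f → (∃ M : ℝ, ∀ y, |f y| ≤ M) →
    Continuous fun u : U => ∫ y, f y ∂(T (x, u))

/-- Weak convergence: convergence of the integrals of all bounded continuous functions. -/
def WeakTendsto [TopologicalSpace X] (μ : ℕ → Measure X) (ν : Measure X) : Prop :=
  ∀ f : X →ᵇ ℝ, Tendsto (fun n => ∫ x, f x ∂(μ n)) atTop (𝓝 (∫ x, f x ∂ν))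

/-- `T(· | x, u)` is weakly continuous in `(x, u)`. -/
def WeaklyContinuous [TopologicalSpace X] [TopologicalSpace U] (T : Kernel (X × U) X) : Prop :=
  ∀ f : X →ᵇ ℝ, Continuous fun p : X × U => ∫ y, f y ∂(T p)

end Model

end AvgCostMDP

/-! The proof is a vanishing discount argument that uses finitely many value iterates instead of the
discounted value function. Let `v` be the `k`-th iterate for the discount factor `α`, with `α ^ k *
M ≤ 1 - α`. Then `v` solves the discounted optimality equation up to `1 - α`. Under a nearly
minimizing stationary policy, `v` is the discounted cost of a function bounded by `M + 2`, so the
`t`-step contraction bounds its oscillation by `C = 2 * t * (M + 2) / (1 - β)`, whatever `α` and `k`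
are (`sub_le_of_tvDist_pow_le`).

Consequently `ρ = (1 - α) * v x₀` and `v - v x₀` solve the average cost optimality equation up to
`(1 - α) * (C + 2)`. Telescoping along an arbitrary policy (`le_totalCost_add`) turns this into the
same bound for the distance from the optimal average cost to `ρ`
(`abs_optAvgCost_sub_valueIter_le`).

This error is uniform over the family of kernels. With `α` near `1` and `k` fixed, it remains to let
`n → ∞` in the `k`-th iterate at `x₀`, by induction on `k`. Each step needs convergence of integrals
with varying integrand and measure (the two `tendsto_integral` lemmas) and of infima over the
compact action space (`tendsto_iInf_of_compactSpace`). -/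

namespace AvgCostMDP

/-! ### Continuous convergence and infima over compact spaces -/

/-- Continuous convergence along full sequences implies joint convergence. -/
theorem tendsto_atTop_prod_nhds_of_seq {Y Z : Type*} [TopologicalSpace Y]
    [FirstCountableTopology Y] [TopologicalSpace Z] {f : ℕ → Y → Z} {y : Y} {z : Z}
    (h : ∀ ys : ℕ → Y, Tendsto ys atTop (𝓝 y) → Tendsto (fun n => f n (ys n)) atTop (𝓝 z)) :
    Tendsto (fun p : ℕ × Y => f p.1 p.2) (atTop ×ˢ 𝓝 y) (𝓝 z) := by
  obtain ⟨B, hB⟩ := (𝓝 y).exists_antitone_basis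
  intro W hW
  by_contra hcon
  have hfreq : ∀ j : ℕ, ∃ᶠ n in atTop, ∃ w ∈ B j, f n w ∉ W := by
    intro j hj
    refine hcon ?_
    rw [mem_map]
    filter_upwards [prod_mem_prod hj (hB.mem j)] with p hp
    by_contra hpW
    exact hp.1 ⟨p.2, hp.2, hpW⟩
  obtain ⟨φ, hφ, hP⟩ := extraction_forall_of_frequently hfreq
  choose w hwB hwW using hP
  -- The hypothesis concerns full sequences only, so the bad points `w`, indexed by the subsequence
  -- `φ`, are completed by the constant `y`.
  have hys : Tendsto (Function.extend φ w fun _ => y) atTop (𝓝 y) := by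
    rw [hB.toHasBasis.tendsto_right_iff]
    intro j _
    filter_upwards [eventually_ge_atTop (φ j)] with n hn
    by_cases hk : ∃ k, φ k = n
    · obtain ⟨k, rfl⟩ := hk
      rw [hφ.injective.extend_apply]
      exact hB.antitone (hφ.le_iff_le.1 hn) (hwB k)
    · rw [Function.extend_apply' _ _ _ hk]
      exact mem_of_mem_nhds (hB.mem j)
  obtain ⟨k, hk⟩ := ((hφ.tendsto_atTop.eventually ((h _ hys).eventually hW))).exists
  rw [hφ.injective.extend_apply] at hk
  exact hwW k hk

/-- Infima over a compact space converge under continuous convergence. -/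
theorem tendsto_iInf_of_compactSpace {ι U : Type*} [TopologicalSpace U] [CompactSpace U]
    [Nonempty U] {l : Filter ι} {F : ι → U → ℝ} {G : U → ℝ}
    (hF : ∀ i, BddBelow (Set.range (F i))) (hG : BddBelow (Set.range G))
    (h : ∀ u, Tendsto (fun p : ι × U => F p.1 p.2) (l ×ˢ 𝓝 u) (𝓝 (G u))) :
    Tendsto (fun i => ⨅ u, F i u) l (𝓝 (⨅ u, G u)) := by
  refine tendsto_order.2 ⟨fun a ha => ?_, fun a ha => ?_⟩
  · obtain ⟨b, hab, hb⟩ := exists_between ha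
    -- Compactness glues the local lower bounds into one that is uniform in `u`. The spare level `b`
    -- keeps the inequality strict after taking the infimum.
    have hmem : {p : ι × U | b < F p.1 p.2} ∈ l ×ˢ 𝓝ˢ (Set.univ : Set U) :=
      isCompact_univ.mem_prod_nhdsSet_of_forall fun u _ =>
        (h u).eventually (lt_mem_nhds (hb.trans_le (ciInf_le hG u)))
    rw [nhdsSet_univ] at hmem
    have hmem' : ∀ᶠ p : ι × U in l ×ˢ ⊤, b < F p.1 p.2 := hmem
    rw [← principal_univ, eventually_prod_principal_iff] at hmem'
    filter_upwards [hmem'] with i hi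
    exact hab.trans_le (le_ciInf fun u => (hi u (Set.mem_univ u)).le)
  · obtain ⟨u, hu⟩ := exists_lt_of_ciInf_lt ha
    have hpair : Tendsto (fun i => (i, u)) l (l ×ˢ 𝓝 u) :=
      tendsto_id.prodMk tendsto_const_nhds
    filter_upwards [((h u).comp hpair).eventually (gt_mem_nhds hu)] with i hi
    exact (ciInf_le (hF i) u).trans_lt hi

/-! ### Setwise convergence with varying integrands -/

section Integrals

variable {X : Type*} [MeasurableSpace X]

theorem integrable_of_abs_le {μ : Measure X} [IsFiniteMeasure μ] {f : X → ℝ} {M : ℝ}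
    (hf : Measurable f) (hM : ∀ x, |f x| ≤ M) : Integrable f μ :=
  Integrable.of_bound hf.aestronglyMeasurable M (ae_of_all _ hM)

theorem abs_integral_le_of_abs_le {μ : Measure X} [IsProbabilityMeasure μ] {f : X → ℝ} {M : ℝ}
    (hM : ∀ x, |f x| ≤ M) : |∫ x, f x ∂μ| ≤ M := by
  simpa using norm_integral_le_of_norm_le_const (μ := μ) (f := f) (C := M) (ae_of_all _ hM)

/-- Dominated convergence along a setwise convergent sequence of measures. -/
theorem SetwiseTendsto.tendsto_integral {μ : ℕ → Measure X} {ν : Measure X}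
    [∀ n, IsProbabilityMeasure (μ n)] [IsProbabilityMeasure ν] (h : SetwiseTendsto μ ν)
    {f : ℕ → X → ℝ} {g : X → ℝ} {M : ℝ} (hf : ∀ n, Measurable (f n)) (hg : Measurable g)
    (hfM : ∀ n x, |f n x| ≤ M) (hgM : ∀ x, |g x| ≤ M)
    (hfg : ∀ x, Tendsto (fun n => f n x) atTop (𝓝 (g x))) :
    Tendsto (fun n => ∫ x, f n x ∂(μ n)) atTop (𝓝 (∫ x, g x ∂ν)) := by
  -- The tail supremum `G m` dominates `|f n - g|` for all `n ≥ m`. Fixing `m` leaves a single test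
  -- function for setwise convergence, and `∫ G m ∂ν` is small by dominated convergence.
  set G : ℕ → X → ℝ := fun m x => ⨆ k : ℕ, |f (m + k) x - g x| with hG
  have hterm : ∀ n x, |f n x - g x| ≤ 2 * M := fun n x =>
    (abs_sub _ _).trans (by linarith [hfM n x, hgM x])
  have hbdd : ∀ m x, BddAbove (Set.range fun k : ℕ => |f (m + k) x - g x|) := fun m x =>
    ⟨2 * M, by rintro _ ⟨k, rfl⟩; exact hterm _ x⟩
  have hGmeas : ∀ m, Measurable (G m) := fun m =>
    Measurable.iSup fun k => ((hf _).sub hg).abs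
  have hGnonneg : ∀ m x, 0 ≤ G m x := fun m x => Real.iSup_nonneg fun _ => abs_nonneg _
  have hGle : ∀ m x, |G m x| ≤ 2 * M := fun m x => by
    rw [abs_of_nonneg (hGnonneg m x)]
    exact ciSup_le fun k => hterm _ x
  have hG0 : ∀ x, Tendsto (fun m => G m x) atTop (𝓝 0) := by
    intro x
    rw [Metric.tendsto_atTop]
    intro ε hε
    obtain ⟨N, hN⟩ := Metric.tendsto_atTop.1 (hfg x) (ε / 2) (by linarith)
    refine ⟨N, fun m hm => ?_⟩
    rw [Real.dist_eq, sub_zero, abs_of_nonneg (hGnonneg m x)]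
    refine lt_of_le_of_lt (ciSup_le fun k => ?_) (half_lt_self hε)
    exact (hN (m + k) (by omega)).le
  have hint : Tendsto (fun m => ∫ x, G m x ∂ν) atTop (𝓝 0) := by
    simpa using tendsto_integral_of_dominated_convergence (μ := ν) (fun _ => 2 * M)
      (fun m => (hGmeas m).aestronglyMeasurable) (integrable_const _)
      (fun m => ae_of_all _ (hGle m)) (ae_of_all _ hG0)
  have hdiff : Tendsto (fun n => ∫ x, f n x ∂(μ n) - ∫ x, g x ∂(μ n)) atTop (𝓝 0) := by
    rw [Metric.tendsto_atTop]
    intro ε hε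
    obtain ⟨m, hm⟩ := (hint.eventually (gt_mem_nhds hε)).exists
    obtain ⟨N, hN⟩ := eventually_atTop.1
      ((h (G m) (hGmeas m) ⟨_, hGle m⟩).eventually (gt_mem_nhds hm))
    refine ⟨max m N, fun n hn => ?_⟩
    rw [Real.dist_eq, sub_zero, ← integral_sub (integrable_of_abs_le (hf n) (hfM n))
      (integrable_of_abs_le hg hgM)]
    refine (abs_integral_le_integral_abs).trans_lt (lt_of_le_of_lt ?_ (hN n (by omega)))
    refine integral_mono ?_ (integrable_of_abs_le (hGmeas m) (hGle m)) fun x => ?_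
    · exact (integrable_of_abs_le ((hf n).sub hg) (hterm n)).abs
    · have := le_ciSup (hbdd m x) (n - m)
      rwa [Nat.add_sub_cancel' (by omega : m ≤ n)] at this
  simpa using hdiff.add (h g hg ⟨M, hgM⟩)

end Integrals

/-! ### Weak convergence with varying integrands -/

section Weak

variable {X : Type*} [PseudoMetricSpace X] [MeasurableSpace X] [OpensMeasurableSpace X]

/-- Weak convergence can only test a fixed continuous function, so the tail `f n`, `n ≥ m`, is
replaced by its `m`-Lipschitz upper envelope `F m`. Continuous convergence makes these envelopes
tend to `g` pointwise. -/
theorem WeakTendsto.eventually_integral_lt {μ : ℕ → Measure X} {ν : Measure X}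
    [∀ n, IsProbabilityMeasure (μ n)] [IsProbabilityMeasure ν] (h : WeakTendsto μ ν)
    {f : ℕ → X → ℝ} {g : X → ℝ} {M : ℝ} (hf : ∀ n, Measurable (f n))
    (hfM : ∀ n x, |f n x| ≤ M)
    (hfg : ∀ x, Tendsto (fun p : ℕ × X => f p.1 p.2) (atTop ×ˢ 𝓝 x) (𝓝 (g x)))
    {a : ℝ} (ha : ∫ x, g x ∂ν < a) :
    ∀ᶠ n in atTop, ∫ x, f n x ∂(μ n) < a := by
  have hne : Nonempty X := nonempty_of_isProbabilityMeasure ν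
  have hM0 : 0 ≤ M := (abs_nonneg _).trans (hfM 0 hne.some)
  set F : ℕ → X → ℝ := fun m x => ⨆ p : ℕ × X, (f (m + p.1) p.2 - m * dist x p.2) with hF
  have hterm : ∀ m x (p : ℕ × X), f (m + p.1) p.2 - m * dist x p.2 ≤ M := fun m x p => by
    have h1 := (abs_le.1 (hfM (m + p.1) p.2)).2
    have h2 : (0 : ℝ) ≤ m * dist x p.2 := by positivity
    linarith
  have hbdd : ∀ m x, BddAbove (Set.range fun p : ℕ × X => f (m + p.1) p.2 - m * dist x p.2) :=
    fun m x => ⟨M, by rintro _ ⟨p, rfl⟩; exact hterm m x p⟩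
  have hfF : ∀ m n x, m ≤ n → f n x ≤ F m x := fun m n x hmn => by
    have := le_ciSup (hbdd m x) (n - m, x)
    simpa [Nat.add_sub_cancel' hmn] using this
  have hFle : ∀ m x, F m x ≤ M := fun m x => ciSup_le (hterm m x)
  have hFabs : ∀ m x, |F m x| ≤ M := fun m x =>
    abs_le.2 ⟨(abs_le.1 (hfM m x)).1.trans (hfF m m x le_rfl), hFle m x⟩
  have hFcont : ∀ m, Continuous (F m) := fun m => by
    refine (LipschitzWith.of_le_add_mul (K := (m : NNReal)) fun x y => ?_).continuous
    refine ciSup_le fun p => ?_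
    have h1 := le_ciSup (hbdd m y) p
    have h2 : (m : ℝ) * dist y p.2 ≤ m * (dist x y + dist x p.2) :=
      mul_le_mul_of_nonneg_left (by rw [dist_comm x y]; exact dist_triangle _ _ _) (by positivity)
    simp only [NNReal.coe_natCast]
    change _ ≤ F m y + _
    simp only [hF]
    linarith
  have hFlim : ∀ x, Tendsto (fun m => F m x) atTop (𝓝 (g x)) := by
    intro x
    have hlow : Tendsto (fun m => f m x) atTop (𝓝 (g x)) :=
      (hfg x).comp (tendsto_id.prodMk tendsto_const_nhds)
    have hgM : -M ≤ g x := ge_of_tendsto' hlow fun m => (abs_le.1 (hfM m x)).1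
    refine tendsto_order.2 ⟨fun b hb => ?_, fun b hb => ?_⟩
    · filter_upwards [hlow.eventually (lt_mem_nhds hb)] with m hm
      exact hm.trans_le (hfF m m x le_rfl)
    · obtain ⟨b', hb', hbb'⟩ := exists_between hb
      have hev := (hfg x).eventually (gt_mem_nhds hb')
      rw [eventually_prod_iff] at hev
      obtain ⟨p, hp, q, hq, hpq⟩ := hev
      obtain ⟨N, hN⟩ := eventually_atTop.1 hp
      obtain ⟨δ, hδ, hδq⟩ := Metric.eventually_nhds_iff.1 hq
      -- For `m ≥ K` the penalty at distance at least `δ` is at least `2 * M`, so such points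
      -- contribute at most `-M ≤ g x`.
      obtain ⟨K, hK⟩ := exists_nat_ge (2 * M / δ)
      filter_upwards [eventually_ge_atTop (max N K)] with m hm
      refine lt_of_le_of_lt (ciSup_le fun r => ?_) hbb'
      rcases lt_or_ge (dist r.2 x) δ with hd | hd
      · have h1 : f (m + r.1) r.2 < b' := hpq (hN _ (by omega)) (hδq hd)
        have h2 : (0 : ℝ) ≤ m * dist x r.2 := by positivity
        linarith
      · have h1 := (abs_le.1 (hfM (m + r.1) r.2)).2
        have hKm : (K : ℝ) ≤ m := by exact_mod_cast (le_max_right N K).trans hm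
        have h2 : 2 * M ≤ m * δ := by
          rw [div_le_iff₀ hδ] at hK
          exact hK.trans (mul_le_mul_of_nonneg_right hKm hδ.le)
        have h3 : (m : ℝ) * δ ≤ m * dist x r.2 :=
          mul_le_mul_of_nonneg_left (by rwa [dist_comm]) (by positivity)
        linarith
  have hint : Tendsto (fun m => ∫ x, F m x ∂ν) atTop (𝓝 (∫ x, g x ∂ν)) :=
    tendsto_integral_of_dominated_convergence (fun _ => M)
      (fun m => (hFcont m).measurable.aestronglyMeasurable) (integrable_const _)
      (fun m => ae_of_all _ (hFabs m)) (ae_of_all _ hFlim)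
  obtain ⟨m, hm⟩ := (hint.eventually (gt_mem_nhds ha)).exists
  have hlim := h (BoundedContinuousFunction.ofNormedAddCommGroup (F m) (hFcont m) M (hFabs m))
  filter_upwards [hlim.eventually (gt_mem_nhds hm), eventually_ge_atTop m] with n hn hmn
  refine lt_of_le_of_lt ?_ hn
  exact integral_mono (integrable_of_abs_le (hf n) (hfM n))
    (integrable_of_abs_le (hFcont m).measurable (hFabs m)) fun x => hfF m n x hmn

/-- Integrals of continuously convergent, uniformly bounded functions converge along a weakly
convergent sequence of measures. -/
theorem WeakTendsto.tendsto_integral {μ : ℕ → Measure X} {ν : Measure X}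
    [∀ n, IsProbabilityMeasure (μ n)] [IsProbabilityMeasure ν] (h : WeakTendsto μ ν)
    {f : ℕ → X → ℝ} {g : X → ℝ} {M : ℝ} (hf : ∀ n, Measurable (f n))
    (hfM : ∀ n x, |f n x| ≤ M)
    (hfg : ∀ x, Tendsto (fun p : ℕ × X => f p.1 p.2) (atTop ×ˢ 𝓝 x) (𝓝 (g x))) :
    Tendsto (fun n => ∫ x, f n x ∂(μ n)) atTop (𝓝 (∫ x, g x ∂ν)) := by
  refine tendsto_order.2 ⟨fun a ha => ?_, fun a ha => h.eventually_integral_lt hf hfM hfg ha⟩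
  have hneg := h.eventually_integral_lt (f := fun n x => -f n x) (g := fun x => -g x)
    (fun n => (hf n).neg) (fun n x => by rw [abs_neg]; exact hfM n x) (fun x => (hfg x).neg)
    (a := -a) (by rw [integral_neg]; linarith)
  filter_upwards [hneg] with n hn
  rw [integral_neg] at hn
  linarith

end Weak

/-! ### Verification: optimality inequalities bound average costs -/

section Verification

variable {X U : Type*} [MeasurableSpace X] [MeasurableSpace U]

theorem measurable_integral_kernel {Y : Type*} [MeasurableSpace Y] (T : Kernel Y X) {v : X → ℝ}
    (hv : Measurable v) : Measurable fun p => ∫ y, v y ∂T p :=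
  hv.stronglyMeasurable.integral_kernel.measurable

theorem integral_infoLaw_succ_last (T : Kernel (X × U) X) [IsMarkovKernel T] (γ : Policy X U)
    (x₀ : X) (t : ℕ) {v : X → ℝ} {C : ℝ} (hv : Measurable v) (hC : ∀ x, |v x| ≤ C) :
    ∫ h, v (h.1 (Fin.last (t + 1))) ∂(infoLaw T γ x₀ (t + 1))
      = ∫ h, ∫ y, v y ∂T (γ.stateAction t h) ∂(infoLaw T γ x₀ t) := by
  have hm : Measurable fun h : Info X U (t + 1) => v (h.1 (Fin.last (t + 1))) :=
    hv.comp ((measurable_pi_apply _).comp measurable_fst)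
  rw [infoLaw, integral_map (γ.measurable_update t).aemeasurable hm.aestronglyMeasurable]
  simp only [Policy.update, Fin.snoc_last]
  rw [Measure.integral_compProd
    (integrable_of_abs_le (f := fun p : Info X U t × X => v p.2) (hv.comp measurable_snd) fun p => hC p.2)]
  rfl

theorem totalCost_succ {c : X × U → ℝ} {M : ℝ} (hc : Measurable c) (hM : ∀ p, |c p| ≤ M)
    (T : Kernel (X × U) X) [IsMarkovKernel T] (γ : Policy X U) (x₀ : X) (N : ℕ) :
    totalCost c T γ x₀ (N + 1)
      = totalCost c T γ x₀ N + ∫ h, c (γ.stateAction N h) ∂(infoLaw T γ x₀ N) := by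
  have hmt : ∀ (n : ℕ) (t : Fin n),
      Measurable fun h : Info X U n => c (h.1 t.castSucc, h.2 t) := fun n t =>
    hc.comp (((measurable_pi_apply _).comp measurable_fst).prodMk
      ((measurable_pi_apply _).comp measurable_snd))
  have hint : Integrable (fun h : Info X U N => ∑ t : Fin N, c (h.1 t.castSucc, h.2 t))
      (infoLaw T γ x₀ N) :=
    integrable_finsetSum _ fun t _ => integrable_of_abs_le (hmt N t) fun _ => hM _
  have hint' : Integrable (fun h => c (γ.stateAction N h)) (infoLaw T γ x₀ N) :=
    integrable_of_abs_le (hc.comp (γ.measurable_stateAction N)) fun _ => hM _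
  have hsum : Measurable fun h : Info X U N =>
      ∑ t : Fin N, c (h.1 t.castSucc, h.2 t) + c (γ.stateAction N h) :=
    (Finset.measurable_fun_sum _ fun t _ => hmt N t).add
      (hc.comp (γ.measurable_stateAction N))
  unfold totalCost
  rw [infoLaw, integral_map (γ.measurable_update N).aemeasurable
    (Finset.measurable_fun_sum _ fun t _ => hmt (N + 1) t).aestronglyMeasurable]
  have hpt : ∀ p : Info X U N × X,
      ∑ t : Fin (N + 1), c ((γ.update N p).1 t.castSucc, (γ.update N p).2 t)
        = ∑ t : Fin N, c (p.1.1 t.castSucc, p.1.2 t) + c (γ.stateAction N p.1) := by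
    intro p
    rw [Fin.sum_univ_castSucc]
    simp [Policy.update, Policy.stateAction]
  simp_rw [hpt]
  rw [Measure.integral_compProd]
  · simp only [integral_const, probReal_univ, one_smul]
    exact integral_add hint hint'
  · refine integrable_of_abs_le (hsum.comp measurable_fst) (M := N * M + M) fun p => ?_
    refine (abs_add_le _ _).trans (add_le_add ?_ (hM _))
    refine (Finset.abs_sum_le_sum_abs _ _).trans ((Finset.sum_le_sum fun t _ => hM _).trans ?_)
    simp

theorem abs_totalCost_le {c : X × U → ℝ} {M : ℝ} (hM : ∀ p, |c p| ≤ M)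
    (T : Kernel (X × U) X) [IsMarkovKernel T] (γ : Policy X U) (x₀ : X) (N : ℕ) :
    |totalCost c T γ x₀ N| ≤ N * M := by
  refine abs_integral_le_of_abs_le fun h => ?_
  refine (Finset.abs_sum_le_sum_abs _ _).trans ((Finset.sum_le_sum fun t _ => hM _).trans ?_)
  simp

theorem abs_average_totalCost_le {c : X × U → ℝ} {M : ℝ} (hM : ∀ p, |c p| ≤ M)
    (T : Kernel (X × U) X) [IsMarkovKernel T] (γ : Policy X U) (x₀ : X) (N : ℕ) :
    |1 / (N : ℝ) * totalCost c T γ x₀ N| ≤ M := by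
  have hM0 : 0 ≤ M := (abs_nonneg _).trans (hM (γ.stateAction 0 (fun _ => x₀, Fin.elim0)))
  -- At `N = 0` the average is `0`, since `1 / 0 = 0`.
  rcases Nat.eq_zero_or_pos N with rfl | hN
  · simpa using hM0
  have hN' : (0 : ℝ) < N := by exact_mod_cast hN
  rw [abs_mul, abs_of_pos (by positivity : 0 < 1 / (N : ℝ)), one_div, inv_mul_le_iff₀ hN']
  exact abs_totalCost_le hM T γ x₀ N

/-- Integrating the one-step inequality against the law of `I_t` and summing over `t` telescopes the
terms in `v`. The policy may depend on the whole history. -/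
theorem le_totalCost_add {c : X × U → ℝ} {M : ℝ} (hc : Measurable c) (hM : ∀ p, |c p| ≤ M)
    (T : Kernel (X × U) X) [IsMarkovKernel T] (γ : Policy X U) (x₀ : X) {v : X → ℝ} {C ρ : ℝ}
    (hv : Measurable v) (hC : ∀ x, |v x| ≤ C)
    (hγ : ∀ t h, ρ + v (h.1 (Fin.last t))
      ≤ c (γ.stateAction t h) + ∫ y, v y ∂T (γ.stateAction t h)) (N : ℕ) :
    N * ρ + v x₀ ≤ totalCost c T γ x₀ N + ∫ h, v (h.1 (Fin.last N)) ∂(infoLaw T γ x₀ N) := by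
  induction N with
  | zero =>
    have hm : Measurable fun h : Info X U 0 => v (h.1 (Fin.last 0)) :=
      hv.comp ((measurable_pi_apply _).comp measurable_fst)
    simp only [totalCost, infoLaw]
    rw [integral_dirac' _ _ hm.stronglyMeasurable]
    simp
  | succ N ih =>
    rw [totalCost_succ hc hM, integral_infoLaw_succ_last T γ x₀ N hv hC]
    have hm : Measurable fun h : Info X U N => v (h.1 (Fin.last N)) :=
      hv.comp ((measurable_pi_apply _).comp measurable_fst)
    have i1 : Integrable (fun h : Info X U N => v (h.1 (Fin.last N))) (infoLaw T γ x₀ N) :=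
      integrable_of_abs_le hm fun _ => hC _
    have i2 : Integrable (fun h => c (γ.stateAction N h)) (infoLaw T γ x₀ N) :=
      integrable_of_abs_le (hc.comp (γ.measurable_stateAction N)) fun _ => hM _
    have i3 : Integrable (fun h => ∫ y, v y ∂T (γ.stateAction N h)) (infoLaw T γ x₀ N) :=
      integrable_of_abs_le ((measurable_integral_kernel T hv).comp (γ.measurable_stateAction N))
        fun _ => abs_integral_le_of_abs_le hC
    have key := integral_mono (μ := infoLaw T γ x₀ N) ((integrable_const ρ).add i1) (i2.add i3)
      (hγ N)
    simp only [Pi.add_apply] at key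
    rw [integral_add (integrable_const ρ) i1, integral_add i2 i3] at key
    simp only [integral_const, probReal_univ, one_smul] at key
    push_cast
    linarith

theorem totalCost_neg (c : X × U → ℝ) (T : Kernel (X × U) X) (γ : Policy X U) (x₀ : X) (N : ℕ) :
    totalCost (fun p => -c p) T γ x₀ N = -totalCost c T γ x₀ N := by
  simp only [totalCost, Finset.sum_neg_distrib, integral_neg]

theorem mul_le_totalCost {c : X × U → ℝ} {M : ℝ} (hc : Measurable c) (hM : ∀ p, |c p| ≤ M)
    (T : Kernel (X × U) X) [IsMarkovKernel T] (γ : Policy X U) (x₀ : X) {v : X → ℝ} {C ρ : ℝ}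
    (hv : Measurable v) (hC : ∀ x, |v x| ≤ C)
    (hγ : ∀ t h, ρ + v (h.1 (Fin.last t))
      ≤ c (γ.stateAction t h) + ∫ y, v y ∂T (γ.stateAction t h)) (N : ℕ) :
    N * ρ - 2 * C ≤ totalCost c T γ x₀ N := by
  have h1 := le_totalCost_add hc hM T γ x₀ hv hC hγ N
  have h2 : |∫ h, v (h.1 (Fin.last N)) ∂(infoLaw T γ x₀ N)| ≤ C :=
    abs_integral_le_of_abs_le fun _ => hC _
  linarith [(abs_le.1 h2).2, (abs_le.1 (hC x₀)).1]

theorem tendsto_add_const_div (ρ K : ℝ) :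
    Tendsto (fun N : ℕ => ρ + K / (N : ℝ)) atTop (𝓝 ρ) := by
  simpa using (tendsto_const_nhds (x := ρ)).add (tendsto_const_div_atTop_nhds_zero_nat K)

theorem le_avgCost {c : X × U → ℝ} {M : ℝ} (hc : Measurable c) (hM : ∀ p, |c p| ≤ M)
    (T : Kernel (X × U) X) [IsMarkovKernel T] (γ : Policy X U) (x₀ : X) {v : X → ℝ} {C ρ : ℝ}
    (hv : Measurable v) (hC : ∀ x, |v x| ≤ C)
    (hγ : ∀ t h, ρ + v (h.1 (Fin.last t))
      ≤ c (γ.stateAction t h) + ∫ y, v y ∂T (γ.stateAction t h)) :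
    ρ ≤ avgCost c T γ x₀ := by
  have hlim := tendsto_add_const_div ρ (-(2 * C))
  rw [← hlim.limsup_eq, avgCost]
  refine limsup_le_limsup ?_ hlim.isCoboundedUnder_le
    (isBoundedUnder_of ⟨M, fun N => (abs_le.1 (abs_average_totalCost_le hM T γ x₀ N)).2⟩)
  filter_upwards [eventually_gt_atTop 0] with N hN
  have hN' : (0 : ℝ) < N := by exact_mod_cast hN
  have := mul_le_totalCost hc hM T γ x₀ hv hC hγ N
  rw [one_div, inv_mul_eq_div, le_div_iff₀ hN', add_mul, div_mul_cancel₀ _ hN'.ne']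
  linarith

theorem avgCost_le {c : X × U → ℝ} {M : ℝ} (hc : Measurable c) (hM : ∀ p, |c p| ≤ M)
    (T : Kernel (X × U) X) [IsMarkovKernel T] (γ : Policy X U) (x₀ : X) {v : X → ℝ} {C ρ : ℝ}
    (hv : Measurable v) (hC : ∀ x, |v x| ≤ C)
    (hγ : ∀ t h, c (γ.stateAction t h) + ∫ y, v y ∂T (γ.stateAction t h)
      ≤ ρ + v (h.1 (Fin.last t))) :
    avgCost c T γ x₀ ≤ ρ := by
  have hlim := tendsto_add_const_div ρ (2 * C)
  rw [← hlim.limsup_eq, avgCost]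
  refine limsup_le_limsup ?_ (IsBoundedUnder.isCoboundedUnder_le
    (isBoundedUnder_of ⟨-M, fun N => (abs_le.1 (abs_average_totalCost_le hM T γ x₀ N)).1⟩))
    hlim.isBoundedUnder_le
  filter_upwards [eventually_gt_atTop 0] with N hN
  have hN' : (0 : ℝ) < N := by exact_mod_cast hN
  -- The upper bound is the lower bound for `-c`, `-v` and `-ρ`.
  have := mul_le_totalCost (c := fun p => -c p) hc.neg (fun p => (abs_neg _).trans_le (hM p)) T γ
    x₀ (v := fun x => -v x) (C := C) (ρ := -ρ) hv.neg (fun x => (abs_neg _).trans_le (hC x))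
    (fun t h => by rw [integral_neg]; linarith [hγ t h]) N
  rw [totalCost_neg] at this
  rw [one_div, inv_mul_eq_div, div_le_iff₀ hN', add_mul, div_mul_cancel₀ _ hN'.ne']
  linarith

/-- The stationary policy that uses `γ` at every time. -/
def Policy.stationary (γ : X → U) (hγ : Measurable γ) : Policy X U where
  act t h := γ (h.1 (Fin.last t))
  measurable_act _ := hγ.comp ((measurable_pi_apply _).comp measurable_fst)

/-- An approximate solution of the average cost optimality equation bounds the optimal cost. -/
theorem abs_optAvgCost_sub_le {c : X × U → ℝ} {M : ℝ} (hc : Measurable c)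
    (hM : ∀ p, |c p| ≤ M) (T : Kernel (X × U) X) [IsMarkovKernel T] (x₀ : X) {v : X → ℝ}
    {C ρ ε : ℝ} (hv : Measurable v) (hC : ∀ x, |v x| ≤ C)
    (hlow : ∀ x u, ρ - ε + v x ≤ c (x, u) + ∫ y, v y ∂T (x, u))
    {γ : X → U} (hγ : Measurable γ)
    (hupp : ∀ x, c (x, γ x) + ∫ y, v y ∂T (x, γ x) ≤ ρ + ε + v x) :
    |optAvgCost c T x₀ - ρ| ≤ ε := by
  have hle : ∀ π : Policy X U, ρ - ε ≤ avgCost c T π x₀ := fun π =>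
    le_avgCost hc hM T π x₀ hv hC fun t h => hlow _ _
  have hne : Nonempty (Policy X U) := ⟨Policy.stationary γ hγ⟩
  have h1 : ρ - ε ≤ optAvgCost c T x₀ := le_ciInf hle
  have h2 : optAvgCost c T x₀ ≤ ρ + ε :=
    (ciInf_le ⟨ρ - ε, by rintro _ ⟨π, rfl⟩; exact hle π⟩ (Policy.stationary γ hγ)).trans
      (avgCost_le hc hM T _ x₀ hv hC fun t h => hupp _)
  rw [abs_le]
  constructor <;> linarith

end Verification

/-! ### Total variation contraction and oscillation of discounted costs -/

section Ergodic

variable {X : Type*} [MeasurableSpace X]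

theorem abs_integral_sub_le_tvDist (μ ν : Measure X) [IsProbabilityMeasure μ]
    [IsProbabilityMeasure ν] {f : X → ℝ} (hf : Measurable f) (hf1 : ∀ x, |f x| ≤ 1) :
    |∫ x, f x ∂μ - ∫ x, f x ∂ν| ≤ tvDist μ ν := by
  refine le_csSup ⟨2, ?_⟩ ⟨f, hf, hf1, rfl⟩
  rintro _ ⟨g, -, hg1, rfl⟩
  have h1 := abs_integral_le_of_abs_le (μ := μ) hg1
  have h2 := abs_integral_le_of_abs_le (μ := ν) hg1
  exact (abs_sub _ _).trans (by linarith)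

/-- Centring `f` at the middle of an interval of length `D` containing its range and scaling by `2 /
D` gives a test function bounded by `1`; the factor `2` cancels the one in `2 * β`. -/
theorem integral_sub_integral_le_of_tvDist_le (μ ν : Measure X) [IsProbabilityMeasure μ]
    [IsProbabilityMeasure ν] {β : ℝ} (h : tvDist μ ν ≤ 2 * β) {f : X → ℝ} (hf : Measurable f)
    {B D : ℝ} (hB : ∀ x, |f x| ≤ B) (hD : 0 < D) (hosc : ∀ x y, f x - f y ≤ D) :
    ∫ x, f x ∂μ - ∫ x, f x ∂ν ≤ β * D := by
  have hne : Nonempty X := nonempty_of_isProbabilityMeasure μ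
  have hbb : BddBelow (Set.range f) := ⟨-B, by rintro _ ⟨x, rfl⟩; exact (abs_le.1 (hB x)).1⟩
  set a := ⨅ x, f x with ha
  have h1 : ∀ x, a ≤ f x := fun x => ciInf_le hbb x
  have h2 : ∀ x, f x ≤ a + D := fun x => by
    have : f x - D ≤ a := le_ciInf fun y => by linarith [hosc x y]
    linarith
  have hg : Measurable fun x => 2 / D * (f x - (a + D / 2)) := (hf.sub_const _).const_mul _
  have hg1 : ∀ x, |2 / D * (f x - (a + D / 2))| ≤ 1 := fun x => by
    rw [abs_mul, abs_of_pos (by positivity : 0 < 2 / D), div_mul_eq_mul_div, div_le_one hD]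
    have : |f x - (a + D / 2)| ≤ D / 2 := abs_le.2 ⟨by linarith [h1 x], by linarith [h2 x]⟩
    linarith
  have key := (le_abs_self _).trans ((abs_integral_sub_le_tvDist μ ν hg hg1).trans h)
  have hint : ∀ (κ : Measure X) [IsProbabilityMeasure κ],
      ∫ x, 2 / D * (f x - (a + D / 2)) ∂κ = 2 / D * (∫ x, f x ∂κ - (a + D / 2)) := by
    intro κ _
    rw [integral_const_mul, integral_sub (integrable_of_abs_le hf hB) (integrable_const _)]
    simp
  rw [hint μ, hint ν, ← mul_sub, sub_sub_sub_cancel_right, div_mul_eq_mul_div,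
    div_le_iff₀ hD] at key
  linarith

instance isMarkovKernel_pow (K : Kernel X X) [IsMarkovKernel K] (n : ℕ) :
    IsMarkovKernel (K ^ n) := by
  induction n with
  | zero => rw [pow_zero]; exact inferInstanceAs (IsMarkovKernel Kernel.id)
  | succ n ih => rw [pow_succ']; exact inferInstanceAs (IsMarkovKernel (K ∘ₖ (K ^ n)))

theorem integral_pow_zero (K : Kernel X X) {f : X → ℝ} (hf : Measurable f) (x : X) :
    ∫ y, f y ∂(K ^ 0) x = f x := by
  have : (K ^ 0) x = Measure.dirac x := by
    rw [pow_zero]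
    exact Kernel.id_apply x
  rw [this, integral_dirac' _ _ hf.stronglyMeasurable]

theorem integral_pow_succ (K : Kernel X X) [IsMarkovKernel K] {f : X → ℝ} {B : ℝ}
    (hf : Measurable f) (hB : ∀ x, |f x| ≤ B) (n : ℕ) (x : X) :
    ∫ y, f y ∂(K ^ (n + 1)) x = ∫ y, ∫ z, f z ∂K y ∂(K ^ n) x := by
  have hmul : K ^ (n + 1) = K ∘ₖ (K ^ n) := pow_succ' K n
  have hprob : IsProbabilityMeasure ((K ∘ₖ (K ^ n)) x) := inferInstance
  rw [hmul]
  exact Kernel.integral_comp (integrable_of_abs_le hf hB)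

theorem eq_sum_pow_of_eq_add_integral (K : Kernel X X) [IsMarkovKernel K] {α A B : ℝ}
    {f v : X → ℝ} (hf : Measurable f) (hv : Measurable v) (hA : ∀ x, |f x| ≤ A)
    (hB : ∀ x, |v x| ≤ B) (hfv : ∀ x, v x = f x + α * ∫ y, v y ∂K x) (n : ℕ) (x : X) :
    v x = ∑ k ∈ Finset.range n, α ^ k * ∫ y, f y ∂(K ^ k) x + α ^ n * ∫ y, v y ∂(K ^ n) x := by
  induction n with
  | zero => simpa using (integral_pow_zero K hv x).symm
  | succ n ih =>
    have hstep : ∫ y, v y ∂(K ^ n) x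
        = ∫ y, f y ∂(K ^ n) x + α * ∫ y, v y ∂(K ^ (n + 1)) x := by
      rw [integral_pow_succ K hv hB, ← integral_const_mul, ← integral_add
        (integrable_of_abs_le hf hA)]
      · exact integral_congr_ae (ae_of_all _ hfv)
      · exact (integrable_of_abs_le (measurable_integral_kernel K hv)
          fun _ => abs_integral_le_of_abs_le hB).const_mul _
    rw [Finset.sum_range_succ, ih, hstep]
    ring

/-- Under a `t`-step contraction, discounted costs oscillate boundedly, uniformly in the
discount factor. -/
theorem sub_le_of_tvDist_pow_le (K : Kernel X X) [IsMarkovKernel K] {t : ℕ} (ht : 0 < t)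
    {β : ℝ} (hβ0 : 0 ≤ β) (hβ1 : β < 1)
    (hK : ∀ x x', tvDist ((K ^ t) x) ((K ^ t) x') ≤ 2 * β) {α A B : ℝ} (hα0 : 0 ≤ α)
    (hα1 : α ≤ 1) {f v : X → ℝ} (hf : Measurable f) (hv : Measurable v) (hA : ∀ x, |f x| ≤ A)
    (hB : ∀ x, |v x| ≤ B) (hfv : ∀ x, v x = f x + α * ∫ y, v y ∂K x) (x x' : X) :
    v x - v x' ≤ 2 * t * A / (1 - β) := by
  have hA0 : 0 ≤ A := (abs_nonneg _).trans (hA x)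
  set D := ⨆ p : X × X, (v p.1 - v p.2) with hDdef
  have hbdd : BddAbove (Set.range fun p : X × X => v p.1 - v p.2) := by
    refine ⟨2 * B, ?_⟩
    rintro _ ⟨p, rfl⟩
    have h1 := (abs_le.1 (hB p.1)).2
    have h2 := (abs_le.1 (hB p.2)).1
    simp only
    linarith
  have hD : ∀ y y', v y - v y' ≤ D := fun y y' => le_ciSup hbdd (y, y')
  have hβ' : 0 < 1 - β := by linarith
  refine (hD x x').trans ?_
  -- The rescaling by `2 / D` needs `D > 0`.
  rcases le_or_gt D 0 with hD0 | hD0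
  · exact hD0.trans (by positivity)
  have hne : Nonempty (X × X) := ⟨(x, x')⟩
  -- After unrolling `v` over `t` steps, the running terms differ by at most `2 * t * A`, and the
  -- contraction shrinks the oscillation of the remainder to `β * D`. Bounding every power of `α` by
  -- `1` removes the dependence on the discount factor.
  have hstep : D ≤ 2 * t * A + β * D := by
    refine ciSup_le fun p => ?_
    rw [eq_sum_pow_of_eq_add_integral K hf hv hA hB hfv t p.1,
      eq_sum_pow_of_eq_add_integral K hf hv hA hB hfv t p.2]
    have hsum : ∀ y, |∑ k ∈ Finset.range t, α ^ k * ∫ z, f z ∂(K ^ k) y| ≤ t * A := by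
      intro y
      refine (Finset.abs_sum_le_sum_abs _ _).trans
        ((Finset.sum_le_sum fun k _ => (?_ : _ ≤ A)).trans (by simp))
      rw [abs_mul, abs_of_nonneg (pow_nonneg hα0 k)]
      exact (mul_le_of_le_one_left (abs_nonneg _) (pow_le_one₀ hα0 hα1)).trans
        (abs_integral_le_of_abs_le hA)
    have h1 := (abs_le.1 (hsum p.1)).2
    have h2 := (abs_le.1 (hsum p.2)).1
    have h3 := integral_sub_integral_le_of_tvDist_le _ _ (hK p.1 p.2) hv hB hD0 hD
    have h4 : α ^ t * (∫ y, v y ∂(K ^ t) p.1 - ∫ y, v y ∂(K ^ t) p.2) ≤ β * D :=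
      (mul_le_mul_of_nonneg_left h3 (pow_nonneg hα0 t)).trans
        (mul_le_of_le_one_left (by positivity) (pow_le_one₀ hα0 hα1))
    rw [mul_sub] at h4
    linarith
  rw [le_div_iff₀ hβ']
  linarith

end Ergodic

/-! ### Discounted value iteration -/

section ValueIteration

variable {X U : Type*} [MeasurableSpace X] [MeasurableSpace U]

/-- The one-step discounted cost with terminal cost `v`. -/
noncomputable def qValue (c : X × U → ℝ) (T : Kernel (X × U) X) (α : ℝ) (v : X → ℝ)
    (p : X × U) : ℝ :=
  c p + α * ∫ y, v y ∂T p

/-- The iterates of the discounted Bellman operator, started at `0`. -/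
noncomputable def valueIter (c : X × U → ℝ) (T : Kernel (X × U) X) (α : ℝ) : ℕ → X → ℝ
  | 0 => fun _ => 0
  | k + 1 => fun x => ⨅ u, qValue c T α (valueIter c T α k) (x, u)

theorem abs_iInf_le_of_abs_le {ι : Type*} [Nonempty ι] {F : ι → ℝ} {B : ℝ}
    (hF : ∀ i, |F i| ≤ B) : |⨅ i, F i| ≤ B := by
  have hbb : BddBelow (Set.range F) := ⟨-B, by rintro _ ⟨i, rfl⟩; exact (abs_le.1 (hF i)).1⟩
  exact abs_le.2 ⟨le_ciInf fun i => (abs_le.1 (hF i)).1,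
    (ciInf_le hbb (Classical.arbitrary ι)).trans (abs_le.1 (hF _)).2⟩

theorem abs_iInf_sub_iInf_le {ι : Type*} [Nonempty ι] {F G : ι → ℝ} {e : ℝ}
    (hF : BddBelow (Set.range F)) (hG : BddBelow (Set.range G)) (h : ∀ i, |F i - G i| ≤ e) :
    |(⨅ i, F i) - ⨅ i, G i| ≤ e := by
  have h1 : (⨅ i, F i) - e ≤ ⨅ i, G i := le_ciInf fun i => by
    linarith [ciInf_le hF i, (abs_le.1 (h i)).2]
  have h2 : (⨅ i, G i) - e ≤ ⨅ i, F i := le_ciInf fun i => by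
    linarith [ciInf_le hG i, (abs_le.1 (h i)).1]
  exact abs_le.2 ⟨by linarith, by linarith⟩

theorem measurable_qValue {c : X × U → ℝ} (hc : Measurable c) (T : Kernel (X × U) X) (α : ℝ)
    {v : X → ℝ} (hv : Measurable v) : Measurable (qValue c T α v) :=
  hc.add ((measurable_integral_kernel T hv).const_mul α)

variable {c : X × U → ℝ} {M : ℝ} {T : Kernel (X × U) X} [IsMarkovKernel T] {α : ℝ}

theorem abs_qValue_le (hM : ∀ p, |c p| ≤ M) (hα0 : 0 ≤ α) {v : X → ℝ} {B : ℝ}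
    (hB : ∀ x, |v x| ≤ B) (p : X × U) : |qValue c T α v p| ≤ M + α * B := by
  refine (abs_add_le _ _).trans (add_le_add (hM p) ?_)
  rw [abs_mul, abs_of_nonneg hα0]
  exact mul_le_mul_of_nonneg_left (abs_integral_le_of_abs_le hB) hα0

theorem bddBelow_range_qValue (hM : ∀ p, |c p| ≤ M) (hα0 : 0 ≤ α) {v : X → ℝ} {B : ℝ}
    (hB : ∀ x, |v x| ≤ B) (x : X) : BddBelow (Set.range fun u => qValue c T α v (x, u)) :=
  ⟨-(M + α * B), by rintro _ ⟨u, rfl⟩; exact (abs_le.1 (abs_qValue_le hM hα0 hB (x, u))).1⟩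

theorem abs_valueIter_le [Nonempty U] (hM : ∀ p, |c p| ≤ M) (hα0 : 0 ≤ α) (hα1 : α < 1)
    (k : ℕ) (x : X) : |valueIter c T α k x| ≤ M / (1 - α) := by
  have hα' : 0 < 1 - α := by linarith
  have hM0 : 0 ≤ M := (abs_nonneg _).trans (hM (x, Classical.arbitrary U))
  induction k generalizing x with
  | zero => simpa [valueIter] using div_nonneg hM0 hα'.le
  | succ k ih =>
    refine abs_iInf_le_of_abs_le fun u => ?_
    refine (abs_qValue_le hM hα0 ih (x, u)).trans_eq ?_
    field_simp
    ring

theorem bddBelow_range_qValue_valueIter [Nonempty U] (hM : ∀ p, |c p| ≤ M) (hα0 : 0 ≤ α)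
    (hα1 : α < 1) (k : ℕ) (x : X) :
    BddBelow (Set.range fun u => qValue c T α (valueIter c T α k) (x, u)) :=
  bddBelow_range_qValue hM hα0 (abs_valueIter_le hM hα0 hα1 k) x

/-- The Bellman operator contracts the supremum norm by `α`, and the first increment is at most `M`.
-/
theorem abs_valueIter_succ_sub_le [Nonempty U] (hM : ∀ p, |c p| ≤ M) (hα0 : 0 ≤ α)
    (hα1 : α < 1) (hmeas : ∀ k, Measurable (valueIter c T α k)) (k : ℕ) (x : X) :
    |valueIter c T α (k + 1) x - valueIter c T α k x| ≤ α ^ k * M := by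
  induction k generalizing x with
  | zero =>
    have h0 := abs_iInf_le_of_abs_le (F := fun u => qValue c T α (fun _ => 0) (x, u))
      fun u => abs_qValue_le hM hα0 (B := 0) (by simp) (x, u)
    simpa [valueIter] using h0
  | succ k ih =>
    refine abs_iInf_sub_iInf_le (bddBelow_range_qValue_valueIter hM hα0 hα1 (k + 1) x)
      (bddBelow_range_qValue_valueIter hM hα0 hα1 k x) fun u => ?_
    have hint : ∀ j, Integrable (valueIter c T α j) (T (x, u)) := fun j =>
      integrable_of_abs_le (hmeas j) (abs_valueIter_le hM hα0 hα1 j)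
    rw [qValue, qValue, add_sub_add_left_eq_sub, ← mul_sub, ← integral_sub (hint _) (hint _),
      abs_mul, abs_of_nonneg hα0, pow_succ', mul_assoc]
    exact mul_le_mul_of_nonneg_left (abs_integral_le_of_abs_le ih) hα0

end ValueIteration

/-! ### Measurable selection and the vanishing discount estimate -/

section Selection

theorem iInf_eq_iInf_denseSeq {U : Type*} [TopologicalSpace U]
    [TopologicalSpace.SeparableSpace U] [Nonempty U] {G : U → ℝ} (hG : Continuous G)
    (hb : BddBelow (Set.range G)) :
    ⨅ u, G u = ⨅ n, G (TopologicalSpace.denseSeq U n) := by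
  have hb' : BddBelow (Set.range fun n => G (TopologicalSpace.denseSeq U n)) :=
    hb.mono (by rintro _ ⟨n, rfl⟩; exact ⟨_, rfl⟩)
  refine le_antisymm (le_ciInf fun n => ciInf_le hb _) (le_ciInf fun u => ?_)
  exact (TopologicalSpace.denseRange_denseSeq U).induction_on u
    (isClosed_le continuous_const hG) fun n => ciInf_le hb' n

variable {X U : Type*} [MeasurableSpace X] [MeasurableSpace U] [TopologicalSpace U]
  [TopologicalSpace.SeparableSpace U] [Nonempty U]

theorem measurable_iInf_of_continuous {Q : X × U → ℝ} (hQ : Measurable Q)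
    (hcont : ∀ x, Continuous fun u => Q (x, u))
    (hb : ∀ x, BddBelow (Set.range fun u => Q (x, u))) : Measurable fun x => ⨅ u, Q (x, u) := by
  have : (fun x => ⨅ u, Q (x, u)) = fun x => ⨅ n, Q (x, TopologicalSpace.denseSeq U n) :=
    funext fun x => iInf_eq_iInf_denseSeq (hcont x) (hb x)
  rw [this]
  exact Measurable.iInf fun n => hQ.comp (measurable_id.prodMk measurable_const)

/-- Measurable selection of approximate minimizers. -/
theorem exists_measurable_lt_iInf_add {Q : X × U → ℝ} (hQ : Measurable Q)
    (hcont : ∀ x, Continuous fun u => Q (x, u))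
    (hb : ∀ x, BddBelow (Set.range fun u => Q (x, u))) {ε : ℝ} (hε : 0 < ε) :
    ∃ γ : X → U, Measurable γ ∧ ∀ x, Q (x, γ x) < (⨅ u, Q (x, u)) + ε := by
  classical
  have hex : ∀ x, ∃ n, Q (x, TopologicalSpace.denseSeq U n) < (⨅ u, Q (x, u)) + ε := fun x => by
    refine exists_lt_of_ciInf_lt ?_
    rw [← iInf_eq_iInf_denseSeq (hcont x) (hb x)]
    linarith
  -- The selector takes the first point of a dense sequence that is good enough; it is measurable
  -- because it factors through a measurable index in `ℕ`.
  refine ⟨fun x => TopologicalSpace.denseSeq U (Nat.find (hex x)),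
    (measurable_from_nat (f := TopologicalSpace.denseSeq U)).comp (measurable_find hex fun n => ?_),
    fun x => Nat.find_spec (hex x)⟩
  exact measurableSet_lt (hQ.comp (measurable_id.prodMk measurable_const))
    ((measurable_iInf_of_continuous hQ hcont hb).add_const ε)

/-- Value iteration approximates the optimal average cost, with an error controlled by the
discount factor and the ergodicity constants. -/
theorem abs_optAvgCost_sub_valueIter_le {c : X × U → ℝ} {M : ℝ} (hc : Measurable c)
    (hM : ∀ p, |c p| ≤ M) (T : Kernel (X × U) X) [IsMarkovKernel T] {t : ℕ} (ht : 0 < t)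
    {β : ℝ} (hβ0 : 0 < β) (hβ1 : β < 1) (hT : TVContraction T t β) {α : ℝ} (hα0 : 0 ≤ α)
    (hα1 : α < 1) (hmeas : ∀ k, Measurable (valueIter c T α k))
    (hcont : ∀ k x, Continuous fun u => qValue c T α (valueIter c T α k) (x, u)) {k : ℕ}
    (hk : α ^ k * M ≤ 1 - α) (x₀ : X) :
    |optAvgCost c T x₀ - (1 - α) * valueIter c T α k x₀|
      ≤ (1 - α) * (2 * t * (M + 2) / (1 - β) + 2) := by
  set C := 2 * t * (M + 2) / (1 - β) with hC
  set v := valueIter c T α k with hv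
  have hα' : 0 < 1 - α := by linarith
  have hvB := abs_valueIter_le (T := T) hM hα0 hα1 k
  have hQ := measurable_qValue hc T α (hmeas k)
  have hbb := bddBelow_range_qValue_valueIter (T := T) hM hα0 hα1 k
  have hdiff := fun x => (abs_valueIter_succ_sub_le hM hα0 hα1 hmeas k x).trans hk
  obtain ⟨γ, hγ, hγQ⟩ := exists_measurable_lt_iInf_add hQ (hcont k) hbb hα'
  have hlow : ∀ x u, v x - (1 - α) ≤ c (x, u) + α * ∫ y, v y ∂T (x, u) := fun x u => by
    have h1 : valueIter c T α (k + 1) x ≤ _ := ciInf_le (hbb x) u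
    have h2 := (abs_le.1 (hdiff x)).1
    simp only [qValue] at h1
    linarith
  have hupp : ∀ x, c (x, γ x) + α * ∫ y, v y ∂T (x, γ x) ≤ v x + 2 * (1 - α) := fun x => by
    have h1 : qValue c T α v (x, γ x) < valueIter c T α (k + 1) x + (1 - α) := hγQ x
    have h2 := (abs_le.1 (hdiff x)).2
    simp only [qValue] at h1
    linarith
  set K := closedLoop T γ hγ with hK
  have hKm : IsMarkovKernel K := inferInstanceAs (IsMarkovKernel (T.comap _ _))
  have hKint : ∀ x, ∫ y, v y ∂K x = ∫ y, v y ∂T (x, γ x) := fun x => rfl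
  -- With `f := v - α K v` the fixed point equation is exact. The two approximate inequalities put
  -- `f` within `2 * (1 - α) ≤ 2` of the cost, hence the bound `M + 2`.
  have hosc := sub_le_of_tvDist_pow_le K ht hβ0.le hβ1 (hT γ hγ) hα0 hα1.le
    (f := fun x => v x - α * ∫ y, v y ∂K x) (A := M + 2)
    ((hmeas k).sub ((measurable_integral_kernel K (hmeas k)).const_mul α)) (hmeas k)
    (fun x => by
      rw [hKint]
      have h1 := hlow x (γ x)
      have h2 := hupp x
      have h3 := abs_le.1 (hM (x, γ x))
      exact abs_le.2 ⟨by linarith [h3.1], by linarith [h3.2]⟩)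
    hvB (fun x => by ring)
  have hosc' : ∀ x, |v x - v x₀| ≤ C := fun x =>
    abs_le.2 ⟨by linarith [hosc x₀ x], hosc x x₀⟩
  have hint : ∀ p, ∫ y, (v y - v x₀) ∂T p = ∫ y, v y ∂T p - v x₀ := fun p => by
    rw [integral_sub (integrable_of_abs_le (hmeas k) hvB) (integrable_const _)]
    simp [hv]
  have hI : ∀ p, |∫ y, v y ∂T p - v x₀| ≤ C := fun p => by
    rw [← hint]
    exact abs_integral_le_of_abs_le hosc'
  have hI' : ∀ p, |(1 - α) * (∫ y, v y ∂T p - v x₀)| ≤ (1 - α) * C := fun p => by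
    rw [abs_mul, abs_of_pos hα']
    exact mul_le_mul_of_nonneg_left (hI p) hα'.le
  -- Passing from `α ∫ v` to the undiscounted integral of `v - v x₀` produces `ρ = (1 - α) * v x₀`
  -- and an error `(1 - α) * (∫ v - v x₀)`, which is at most `(1 - α) * C` in absolute value.
  refine abs_optAvgCost_sub_le hc hM T x₀ ((hmeas k).sub_const (v x₀)) hosc' (fun x u => ?_) hγ
    fun x => ?_
  · rw [hint]
    linarith [hlow x u, (abs_le.1 (hI' (x, u))).1]
  · rw [hint]
    linarith [hupp x, (abs_le.1 (hI' (x, γ x))).2]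

/-- Under uniform ergodicity, convergence of the discounted value iterates implies convergence of
the optimal average costs. -/
theorem tendsto_optAvgCost_of_valueIter {c : X × U → ℝ} {M : ℝ} (hc : Measurable c)
    (hM : ∀ p, |c p| ≤ M) (T : Kernel (X × U) X) [IsMarkovKernel T]
    (Tn : ℕ → Kernel (X × U) X) [∀ n, IsMarkovKernel (Tn n)]
    (hT : UniformlyErgodic fun _ : Unit => T) (hTn : UniformlyErgodic Tn) (x₀ : X)
    (hmeas : ∀ α k, 0 ≤ α → α < 1 → Measurable (valueIter c T α k))
    (hmeasn : ∀ n α k, 0 ≤ α → α < 1 → Measurable (valueIter c (Tn n) α k))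
    (hcont : ∀ α k x, 0 ≤ α → α < 1 →
      Continuous fun u => qValue c T α (valueIter c T α k) (x, u))
    (hcontn : ∀ n α k x, 0 ≤ α → α < 1 →
      Continuous fun u => qValue c (Tn n) α (valueIter c (Tn n) α k) (x, u))
    (hlim : ∀ α k, 0 ≤ α → α < 1 →
      Tendsto (fun n => valueIter c (Tn n) α k x₀) atTop (𝓝 (valueIter c T α k x₀))) :
    Tendsto (fun n => optAvgCost c (Tn n) x₀) atTop (𝓝 (optAvgCost c T x₀)) := by
  obtain ⟨t, ht, β, hβ0, hβ1, hTC⟩ := hT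
  obtain ⟨t', ht', β', hβ0', hβ1', hTC'⟩ := hTn
  have hM0 : 0 ≤ M := (abs_nonneg _).trans (hM (x₀, Classical.arbitrary U))
  have h1β : 0 < 1 - β := by linarith
  have h1β' : 0 < 1 - β' := by linarith
  set C := 2 * t * (M + 2) / (1 - β) + 2 with hC
  set C' := 2 * t' * (M + 2) / (1 - β') + 2 with hC'
  have hC0 : 0 < C := by positivity
  have hC0' : 0 < C' := by positivity
  rw [Metric.tendsto_atTop]
  intro ε hε
  obtain ⟨δ, hδ0, hδ1, hδC, hδC'⟩ :
      ∃ δ : ℝ, 0 < δ ∧ δ ≤ 1 ∧ δ * C ≤ ε / 4 ∧ δ * C' ≤ ε / 4 := by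
    -- Here `δ = 1 - α`. The cap `1` keeps `α ≥ 0`, and `C + C'` serves the limit kernel and the
    -- family at once. Three errors of at most `ε / 4` remain.
    refine ⟨min 1 (ε / 4 / (C + C')), by positivity, min_le_left _ _, ?_, ?_⟩
    · refine (mul_le_mul_of_nonneg_right (min_le_right _ _) hC0.le).trans ?_
      rw [div_mul_eq_mul_div, div_le_iff₀ (by positivity)]
      nlinarith
    · refine (mul_le_mul_of_nonneg_right (min_le_right _ _) hC0'.le).trans ?_
      rw [div_mul_eq_mul_div, div_le_iff₀ (by positivity)]
      nlinarith
  have hα0 : 0 ≤ 1 - δ := by linarith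
  have hα1 : 1 - δ < 1 := by linarith
  obtain ⟨k, hk⟩ : ∃ k : ℕ, (1 - δ) ^ k * M ≤ 1 - (1 - δ) := by
    have := (tendsto_pow_atTop_nhds_zero_of_lt_one hα0 hα1).mul_const M
    rw [zero_mul] at this
    obtain ⟨k, hk⟩ := (this.eventually (gt_mem_nhds (by linarith : 0 < 1 - (1 - δ)))).exists
    exact ⟨k, hk.le⟩
  have h1 := abs_optAvgCost_sub_valueIter_le hc hM T ht hβ0 hβ1 (hTC ()) hα0 hα1
    (fun k => hmeas _ k hα0 hα1) (fun k x => hcont _ k x hα0 hα1) hk x₀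
  obtain ⟨N, hN⟩ := Metric.tendsto_atTop.1 (hlim (1 - δ) k hα0 hα1) (ε / 4) (by linarith)
  refine ⟨N, fun n hn => ?_⟩
  have h2 := abs_optAvgCost_sub_valueIter_le hc hM (Tn n) ht' hβ0' hβ1' (hTC' n) hα0 hα1
    (fun k => hmeasn n _ k hα0 hα1) (fun k x => hcontn n _ k x hα0 hα1) hk x₀
  have h3 := hN n hn
  rw [← hC, sub_sub_cancel] at h1
  rw [← hC', sub_sub_cancel] at h2
  rw [Real.dist_eq] at h3 ⊢
  have h4 : |δ * valueIter c (Tn n) (1 - δ) k x₀ - δ * valueIter c T (1 - δ) k x₀| ≤ ε / 4 := by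
    rw [← mul_sub, abs_mul, abs_of_pos hδ0]
    exact (mul_le_of_le_one_left (abs_nonneg _) hδ1).trans h3.le
  have h1' := abs_le.1 (h1.trans hδC)
  have h2' := abs_le.1 (h2.trans hδC')
  have h4' := abs_le.1 h4
  exact abs_lt.2 ⟨by linarith [h1'.1, h1'.2, h2'.1, h2'.2, h4'.1],
    by linarith [h1'.1, h1'.2, h2'.1, h2'.2, h4'.2]⟩

end Selection

/-! ### Convergence of value iterates under weak continuity -/

section Weak

variable {X U : Type*} [PseudoMetricSpace X] [MeasurableSpace X] [MeasurableSpace U]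
  [TopologicalSpace U]

theorem WeaklyContinuous.continuous_qValue {c : X × U → ℝ} (hc : Continuous c)
    {T : Kernel (X × U) X} (hT : WeaklyContinuous T) (α : ℝ) {v : X → ℝ} (hv : Continuous v)
    {B : ℝ} (hB : ∀ x, |v x| ≤ B) : Continuous (qValue c T α v) :=
  hc.add (continuous_const.mul
    (hT (BoundedContinuousFunction.ofNormedAddCommGroup v hv B hB)))

variable [CompactSpace U] [Nonempty U]

theorem WeaklyContinuous.continuous_valueIter {c : X × U → ℝ} (hc : Continuous c) {M : ℝ}
    (hM : ∀ p, |c p| ≤ M) {T : Kernel (X × U) X} [IsMarkovKernel T] (hT : WeaklyContinuous T)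
    {α : ℝ} (hα0 : 0 ≤ α) (hα1 : α < 1) (k : ℕ) : Continuous (valueIter c T α k) := by
  induction k with
  | zero => exact continuous_const
  | succ k ih =>
    have hQ := hT.continuous_qValue hc α ih (abs_valueIter_le hM hα0 hα1 k)
    refine continuous_iff_continuousAt.2 fun x => ?_
    refine tendsto_iInf_of_compactSpace
      (F := fun x' u => qValue c T α (valueIter c T α k) (x', u))
      (bddBelow_range_qValue_valueIter hM hα0 hα1 k)
      (bddBelow_range_qValue_valueIter hM hα0 hα1 k x) fun u => ?_
    rw [← nhds_prod_eq]
    exact hQ.tendsto (x, u)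

variable [BorelSpace X] [FirstCountableTopology U]

/-- The induction has to carry joint convergence in `(n, x)`: with weakly converging measures,
pointwise convergence of the integrands would not suffice for the next step. -/
theorem tendsto_valueIter_of_weak {c : X × U → ℝ} (hc : Continuous c) {M : ℝ}
    (hM : ∀ p, |c p| ≤ M) {T : Kernel (X × U) X} [IsMarkovKernel T]
    {Tn : ℕ → Kernel (X × U) X} [∀ n, IsMarkovKernel (Tn n)]
    (hTn : ∀ n, WeaklyContinuous (Tn n))
    (hconv : ∀ (x : X) (u : U) (xs : ℕ → X) (us : ℕ → U),
      Tendsto (fun n => (xs n, us n)) atTop (𝓝 (x, u)) →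
      WeakTendsto (fun n => Tn n (xs n, us n)) (T (x, u)))
    {α : ℝ} (hα0 : 0 ≤ α) (hα1 : α < 1) (k : ℕ) (x : X) :
    Tendsto (fun p : ℕ × X => valueIter c (Tn p.1) α k p.2) (atTop ×ˢ 𝓝 x)
      (𝓝 (valueIter c T α k x)) := by
  induction k generalizing x with
  | zero => exact tendsto_const_nhds
  | succ k ih =>
    refine tendsto_iInf_of_compactSpace
      (F := fun (p : ℕ × X) u => qValue c (Tn p.1) α (valueIter c (Tn p.1) α k) (p.2, u))
      (fun p => bddBelow_range_qValue_valueIter hM hα0 hα1 k p.2)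
      (bddBelow_range_qValue_valueIter hM hα0 hα1 k x) fun u => ?_
    have hjoint : Tendsto
        (fun p : ℕ × (X × U) => qValue c (Tn p.1) α (valueIter c (Tn p.1) α k) p.2)
        (atTop ×ˢ 𝓝 (x, u)) (𝓝 (qValue c T α (valueIter c T α k) (x, u))) := by
      refine tendsto_atTop_prod_nhds_of_seq
        (f := fun n p => qValue c (Tn n) α (valueIter c (Tn n) α k) p) fun ps hps => ?_
      exact ((hc.tendsto _).comp hps).add ((WeakTendsto.tendsto_integral
        (hconv x u (fun n => (ps n).1) (fun n => (ps n).2) hps)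
        (fun n => ((hTn n).continuous_valueIter hc hM hα0 hα1 k).measurable)
        (fun n => abs_valueIter_le hM hα0 hα1 k) ih).const_mul α)
    rw [nhds_prod_eq] at hjoint
    exact hjoint.comp tendsto_prodAssoc

end Weak

/-! ### Convergence of value iterates under setwise continuity -/

section Setwise

variable {X U : Type*} [MeasurableSpace X] [MeasurableSpace U] [TopologicalSpace U]

theorem SetwiseContinuousInAction.continuous_qValue {c : X × U → ℝ}
    (hc : ∀ x, Continuous fun u => c (x, u)) {T : Kernel (X × U) X}
    (hT : SetwiseContinuousInAction T) (α : ℝ) {v : X → ℝ} (hv : Measurable v)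
    {B : ℝ} (hB : ∀ x, |v x| ≤ B) (x : X) : Continuous fun u => qValue c T α v (x, u) :=
  (hc x).add (continuous_const.mul (hT x v hv ⟨B, hB⟩))

variable [TopologicalSpace.SeparableSpace U] [Nonempty U]

theorem SetwiseContinuousInAction.measurable_valueIter {c : X × U → ℝ} (hcm : Measurable c)
    (hc : ∀ x, Continuous fun u => c (x, u)) {M : ℝ} (hM : ∀ p, |c p| ≤ M)
    {T : Kernel (X × U) X} [IsMarkovKernel T] (hT : SetwiseContinuousInAction T)
    {α : ℝ} (hα0 : 0 ≤ α) (hα1 : α < 1) (k : ℕ) : Measurable (valueIter c T α k) := by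
  induction k with
  | zero => exact measurable_const
  | succ k ih =>
    exact measurable_iInf_of_continuous (measurable_qValue hcm T α ih)
      (hT.continuous_qValue hc α ih (abs_valueIter_le hM hα0 hα1 k))
      (bddBelow_range_qValue_valueIter hM hα0 hα1 k)

variable [CompactSpace U] [FirstCountableTopology U]

/-- Setwise convergence tolerates integrands that converge only pointwise, so the state stays fixed
throughout and no regularity in `x` beyond measurability is needed. -/
theorem tendsto_valueIter_of_setwise {c : X × U → ℝ} (hcm : Measurable c)
    (hc : ∀ x, Continuous fun u => c (x, u)) {M : ℝ} (hM : ∀ p, |c p| ≤ M)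
    {T : Kernel (X × U) X} [IsMarkovKernel T]
    {Tn : ℕ → Kernel (X × U) X} [∀ n, IsMarkovKernel (Tn n)]
    (hT : SetwiseContinuousInAction T) (hTn : ∀ n, SetwiseContinuousInAction (Tn n))
    (hconv : ∀ (x : X) (u : U) (us : ℕ → U), Tendsto us atTop (𝓝 u) →
      SetwiseTendsto (fun n => Tn n (x, us n)) (T (x, u)))
    {α : ℝ} (hα0 : 0 ≤ α) (hα1 : α < 1) (k : ℕ) (x : X) :
    Tendsto (fun n => valueIter c (Tn n) α k x) atTop (𝓝 (valueIter c T α k x)) := by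
  induction k generalizing x with
  | zero => exact tendsto_const_nhds
  | succ k ih =>
    refine tendsto_iInf_of_compactSpace
      (F := fun n u => qValue c (Tn n) α (valueIter c (Tn n) α k) (x, u))
      (fun n => bddBelow_range_qValue_valueIter hM hα0 hα1 k x)
      (bddBelow_range_qValue_valueIter hM hα0 hα1 k x) fun u => ?_
    refine tendsto_atTop_prod_nhds_of_seq
      (f := fun n u => qValue c (Tn n) α (valueIter c (Tn n) α k) (x, u)) fun us hus => ?_
    exact (((hc x).tendsto _).comp hus).add (((hconv x u us hus).tendsto_integral
      (fun n => (hTn n).measurable_valueIter hcm hc hM hα0 hα1 k)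
      (hT.measurable_valueIter hcm hc hM hα0 hα1 k)
      (fun n => abs_valueIter_le hM hα0 hα1 k)
      (abs_valueIter_le hM hα0 hα1 k) ih).const_mul α)

end Setwise

/-! ### The empty action space and the main theorem -/

theorem optAvgCost_eq_zero_of_isEmpty {X U : Type*} [MeasurableSpace X] [MeasurableSpace U]
    [IsEmpty U] (c : X × U → ℝ) (T : Kernel (X × U) X) (x₀ : X) : optAvgCost c T x₀ = 0 := by
  have : IsEmpty (Policy X U) := ⟨fun γ => isEmptyElim (γ.act 0 (fun _ => x₀, Fin.elim0))⟩
  exact Real.iInf_of_isEmpty _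

end AvgCostMDP

theorem mainTheorem1 {d m : ℕ}
    (X : Set (EuclideanSpace ℝ (Fin d))) (hX : MeasurableSet X)
    (U : Set (EuclideanSpace ℝ (Fin m))) (hU : IsCompact U)
    (c : X × U → ℝ) (hc_meas : Measurable c) (hc_bdd : ∃ M : ℝ, ∀ p, |c p| ≤ M)
    (T : Kernel (X × U) X) [IsMarkovKernel T]
    (Tn : ℕ → Kernel (X × U) X) [∀ n, IsMarkovKernel (Tn n)]
    (hT : AvgCostMDP.UniformlyErgodic (fun _ : Unit => T))
    (hTn : AvgCostMDP.UniformlyErgodic Tn)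
    (x₀ : X) :
    ((Continuous c ∧
        AvgCostMDP.WeaklyContinuous T ∧ (∀ n, AvgCostMDP.WeaklyContinuous (Tn n)) ∧
        (∀ (x : X) (u : U) (xs : ℕ → X) (us : ℕ → U),
          Tendsto (fun n => (xs n, us n)) atTop (𝓝 (x, u)) →
          AvgCostMDP.WeakTendsto (fun n => Tn n (xs n, us n)) (T (x, u)))) →
      Tendsto (fun n => AvgCostMDP.optAvgCost c (Tn n) x₀) atTop
        (𝓝 (AvgCostMDP.optAvgCost c T x₀))) ∧
    (((∀ x : X, Continuous fun u : U => c (x, u)) ∧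
        AvgCostMDP.SetwiseContinuousInAction T ∧
        (∀ n, AvgCostMDP.SetwiseContinuousInAction (Tn n)) ∧
        (∀ (x : X) (u : U) (us : ℕ → U),
          Tendsto us atTop (𝓝 u) →
          AvgCostMDP.SetwiseTendsto (fun n => Tn n (x, us n)) (T (x, u)))) →
      Tendsto (fun n => AvgCostMDP.optAvgCost c (Tn n) x₀) atTop
        (𝓝 (AvgCostMDP.optAvgCost c T x₀))) := by 
  have hUc : CompactSpace U := isCompact_iff_compactSpace.1 hU
  obtain ⟨M, hM⟩ := hc_bdd
  -- If `U` is empty there are no policies, and every optimal cost is the real infimum of an empty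
  -- family, which is `0` by convention.
  rcases isEmpty_or_nonempty U with hUe | hUne
  · simp [AvgCostMDP.optAvgCost_eq_zero_of_isEmpty]
  refine ⟨?_, ?_⟩
  · rintro ⟨hc, hTw, hTnw, hconv⟩
    have hQ : ∀ (S : Kernel (X × U) X) [IsMarkovKernel S], AvgCostMDP.WeaklyContinuous S →
        ∀ (α : ℝ) (k : ℕ) (x : X), 0 ≤ α → α < 1 →
        Continuous fun u => AvgCostMDP.qValue c S α (AvgCostMDP.valueIter c S α k) (x, u) :=
      fun S _ hS α k x hα0 hα1 =>
        (hS.continuous_qValue hc α (hS.continuous_valueIter hc hM hα0 hα1 k)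
          (AvgCostMDP.abs_valueIter_le hM hα0 hα1 k)).comp (Continuous.prodMk_right x)
    refine AvgCostMDP.tendsto_optAvgCost_of_valueIter hc_meas hM T Tn hT hTn x₀
      (fun α k hα0 hα1 => (hTw.continuous_valueIter hc hM hα0 hα1 k).measurable)
      (fun n α k hα0 hα1 => ((hTnw n).continuous_valueIter hc hM hα0 hα1 k).measurable)
      (hQ T hTw) (fun n => hQ (Tn n) (hTnw n)) fun α k hα0 hα1 => ?_
    exact (AvgCostMDP.tendsto_valueIter_of_weak hc hM hTnw hconv hα0 hα1 k x₀).comp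
      (tendsto_id.prodMk tendsto_const_nhds)
  · rintro ⟨hc, hTs, hTns, hconv⟩
    have hQ : ∀ (S : Kernel (X × U) X) [IsMarkovKernel S],
        AvgCostMDP.SetwiseContinuousInAction S →
        ∀ (α : ℝ) (k : ℕ) (x : X), 0 ≤ α → α < 1 →
        Continuous fun u => AvgCostMDP.qValue c S α (AvgCostMDP.valueIter c S α k) (x, u) :=
      fun S _ hS α k x hα0 hα1 =>
        hS.continuous_qValue hc α (hS.measurable_valueIter hc_meas hc hM hα0 hα1 k)
          (AvgCostMDP.abs_valueIter_le hM hα0 hα1 k) x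
    exact AvgCostMDP.tendsto_optAvgCost_of_valueIter hc_meas hM T Tn hT hTn x₀
      (fun α k hα0 hα1 => hTs.measurable_valueIter hc_meas hc hM hα0 hα1 k)
      (fun n α k hα0 hα1 => (hTns n).measurable_valueIter hc_meas hc hM hα0 hα1 k)
      (hQ T hTs) (fun n => hQ (Tn n) (hTns n)) fun α k hα0 hα1 =>
        AvgCostMDP.tendsto_valueIter_of_setwise hc_meas hc hM hTs hTns hconv hα0 hα1 k x₀
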